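/- Let $a,b$ be natural numbers with $0\le a\le b$ and $b\ge 1$. Conventions: for a simple connected graph $G$ on the vertex set $\{1,\dots,N\}$ with Laplacian matrix $L$, let $L(N)$ be $L$ with its last column deleted. The Laplacian simplex $\mathcal P_G\subset\mathbb R^{N-1}$ is the convex hull of the rows of $L(N)$. A lattice polytope $P\subset\mathbb R^d$ is reflexive if $0$ lies in its interior and its dual $\{x\in\mathbb R^d : x\cdot y\le 1 \text{ for all } y\in P\}$ is also a lattice polytope. If $\mathcal P_G$ is reflexive, its code is $$\mathcal C(\mathcal P_G)=\{x\in(\mathbb Z/N\mathbb Z)^N : x\,[\,L(N)\mid \mathbf 1\,]=0\},$$ and its rate is $\log_N|\mathcal C(\mathcal P_G)|/N$. The bridge of graphs $H_1,\dots,H_k$ on $n$ vertices each is the graph on $\{1,\dots,kn\}$ obtained by placing $H_j$ on the vertices $(j-1)n+1,\dots,jn$ in order and adding the edges $\{mn,mn+1\}$ for $1\le m\le k-1$. **Theorem.** There is a family of graphs $G_n$ ($n\ge 3$ odd), namely $G_n$ is the bridge of $b-a$ copies of the cycle $C_n$ (with its vertices $1,\dots,n$ in cyclic order) followed by $a$ copies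 of the complete graph $K_n$, such that every $G_n$ is connected, every $\mathcal P_{G_n}$ is reflexive, and $$\lim_{\substack{n\to\infty\\ n\ \mathrm{odd}}}\frac{\log_{bn}|\mathcal C(\mathcal P_{G_n})|}{bn}=\frac ab .$$ -/

import Mathlib

open Filter Topology

namespace LaplacianCode

/-- A lattice polytope in `ℝ^d`: the convex hull of finitely many points of `ℤ^d`. -/
def IsLatticePolytope {d : ℕ} (P : Set (Fin d → ℝ)) : Prop :=
  ∃ S : Finset (Fin d → ℤ),
    P = convexHull ℝ ((fun v : Fin d → ℤ => fun i => (v i : ℝ)) '' (S : Set (Fin d → ℤ)))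

/-- The dual polytope `{x | x yᵀ ≤ 1 for all y ∈ P}`. -/
def dualPolytope {d : ℕ} (P : Set (Fin d → ℝ)) : Set (Fin d → ℝ) :=
  {x | ∀ y ∈ P, x ⬝ᵥ y ≤ 1}

/-- A lattice polytope is reflexive if it contains the origin in its interior and its dual
is a lattice polytope. -/
def IsReflexive {d : ℕ} (P : Set (Fin d → ℝ)) : Prop :=
  IsLatticePolytope P ∧ (0 : Fin d → ℝ) ∈ interior P ∧ IsLatticePolytope (dualPolytope P)

open Classical in
/-- The integral Laplacian matrix of a graph on `N` vertices. -/
noncomputable def laplacian {N : ℕ} (G : SimpleGraph (Fin N)) : Matrix (Fin N) (Fin N) ℤ :=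
  G.lapMatrix ℤ

/-- The Laplacian matrix with its last column deleted. -/
noncomputable def vertexMatrix {N : ℕ} (G : SimpleGraph (Fin N)) :
    Matrix (Fin N) (Fin (N - 1)) ℤ :=
  fun i j => laplacian G i (j.castLE (Nat.sub_le N 1))

/-- The Laplacian simplex in `ℝ^(N-1)`: the convex hull of the rows of the Laplacian matrix with
its last column deleted. -/
noncomputable def laplacianSimplex {N : ℕ} (G : SimpleGraph (Fin N)) : Set (Fin (N - 1) → ℝ) :=
  convexHull ℝ (Set.range fun i : Fin N => fun j => (vertexMatrix G i j : ℝ))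

/-- The Laplacian matrix with its last column replaced by the all-ones column. -/
noncomputable def augmentedMatrix {N : ℕ} (G : SimpleGraph (Fin N)) :
    Matrix (Fin N) (Fin N) ℤ :=
  fun i j => if (j : ℕ) + 1 < N then laplacian G i j else 1

/-- The linear code over `ℤ/N` of length `N` associated to a graph on `N` vertices: the kernel of
`x ↦ x M`, where `M` is the Laplacian matrix with its last column replaced by ones. -/
noncomputable def code {N : ℕ} (G : SimpleGraph (Fin N)) :
    Submodule (ZMod N) (Fin N → ZMod N) :=
  LinearMap.ker (Matrix.vecMulLinear ((augmentedMatrix G).map (Int.cast : ℤ → ZMod N)))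

/-- The rate `log_m |C| / n` of a linear code `C` of length `n` over `ℤ/m`. -/
noncomputable def rate {m n : ℕ} (C : Submodule (ZMod m) (Fin n → ZMod m)) : ℝ :=
  Real.logb m (Nat.card C) / n

/-- The bridge of `k` graphs on `n` vertices each. Vertex `i` of the `j`-th graph (both counted
from `0`) becomes vertex `j * n + i`; the last vertex of each graph is joined by an edge to the
first vertex of the next one. -/
def bridge {k n : ℕ} (G : Fin k → SimpleGraph (Fin n)) : SimpleGraph (Fin (k * n)) :=
  SimpleGraph.fromRel fun u v =>
    (u.divNat = v.divNat ∧ (G u.divNat).Adj u.modNat v.modNat) ∨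
    ((u.divNat : ℕ) + 1 = v.divNat ∧ (u.modNat : ℕ) + 1 = n ∧ (v.modNat : ℕ) = 0)

/-- The bridge of `b - a` copies of the cycle `C_n` followed by `a` copies of the complete
graph `K_n`. -/
def cycleCompleteBridge (a b n : ℕ) : SimpleGraph (Fin (b * n)) :=
  bridge fun j : Fin b => if (j : ℕ) < b - a then SimpleGraph.cycleGraph n else ⊤

end LaplacianCode

open scoped Matrix

namespace LaplacianCode

/-! Reflexivity holds once `L x = 1 - N e_i` has an integral solution for every vertex `i`: the
solutions, normalised at the last vertex, are lattice points pairing to `1 - N δ` with the vertices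
of the simplex, so the two families span mutually dual simplices (`isReflexive_laplacianSimplex`).
Such solvability passes from blocks to their bridge (`exists_lap_bridge_eq`). It is immediate for
`K_n`; for `C_n` the quadratic `d (n - d) / 2` works, and it is integral because `n` is odd.

For the rate, the equations at interior vertices of a cycle are a second-order recurrence, so a
cycle block contributes a bounded number of free symbols. In a complete block they force interior
entries to agree up to `n`-torsion of `ℤ/bn`, leaving at most `n` choices each (`card_code_le`).
Conversely, zero-sum torsion words vanishing at both block ends are codewords (`le_card_code`). Up
to a bounded power of `bn`, the code thus has `n ^ (a n)` words, and `log_{bn} n → 1` gives the rate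
`a / b`. -/

/-! ### The Laplacian as an operator on functions -/

/-- The graph Laplacian acting on functions with values in an additive group. -/
noncomputable def lap {V A : Type*} [Fintype V] [AddCommGroup A] (G : SimpleGraph V) :
    (V → A) →+ (V → A) := by
  classical
  exact
  { toFun := fun x u => ∑ v, if G.Adj u v then x u - x v else 0
    map_zero' := by ext; simp
    map_add' := fun x y => by
      ext u
      simp only [Pi.add_apply, ← Finset.sum_add_distrib]
      refine Finset.sum_congr rfl fun v _ => ?_
      split_ifs
      · abel
      · simp }

open Classical in
theorem lap_apply {V A : Type*} [Fintype V] [AddCommGroup A] (G : SimpleGraph V) (x : V → A)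
    (u : V) : lap G x u = ∑ v, if G.Adj u v then x u - x v else 0 := rfl

theorem lapMatrix_mulVec_eq_lap {V R : Type*} [Fintype V] [DecidableEq V] [CommRing R]
    (G : SimpleGraph V) [DecidableRel G.Adj] (x : V → R) :
    G.lapMatrix R *ᵥ x = lap G x := by
  classical
  ext u
  rw [SimpleGraph.lapMatrix_mulVec_apply, lap_apply]
  have h : (∑ v, if G.Adj u v then x u - x v else 0) = ∑ v ∈ G.neighborFinset u, (x u - x v) := by
    rw [SimpleGraph.neighborFinset_eq_filter, Finset.sum_filter]
  rw [Finset.sum_sub_distrib, Finset.sum_const, nsmul_eq_mul,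
    SimpleGraph.card_neighborFinset_eq_degree] at h
  rw [← h]
  congr!

theorem laplacian_map_eq {N : ℕ} (R : Type*) [CommRing R] (G : SimpleGraph (Fin N))
    [DecidableRel G.Adj] : (laplacian G).map (Int.cast : ℤ → R) = G.lapMatrix R := by
  ext i j
  simp only [laplacian, SimpleGraph.lapMatrix, SimpleGraph.degMatrix, SimpleGraph.adjMatrix,
    Matrix.map_apply, Matrix.sub_apply, Matrix.diagonal_apply, Matrix.of_apply]
  push_cast
  congr 1
  · split_ifs
    · congr!
    · rfl

theorem vecMul_laplacian_map {N : ℕ} {R : Type*} [CommRing R] (G : SimpleGraph (Fin N))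
    (x : Fin N → R) : Matrix.vecMul x ((laplacian G).map (Int.cast : ℤ → R)) = lap G x := by
  classical
  rw [laplacian_map_eq, ← lapMatrix_mulVec_eq_lap, ← Matrix.vecMul_transpose,
    SimpleGraph.isSymm_lapMatrix]

theorem eq_of_lap_eq_zero {V : Type*} [Fintype V] {G : SimpleGraph V} (hG : G.Connected)
    {x : V → ℤ} (hx : lap G x = 0) (u v : V) : x u = x v := by
  classical
  have h : G.lapMatrix ℝ *ᵥ (fun i => (x i : ℝ)) = 0 := by
    rw [lapMatrix_mulVec_eq_lap]
    ext u
    have := congrFun hx u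
    rw [lap_apply] at this ⊢
    have h2 := congrArg (Int.cast : ℤ → ℝ) this
    push_cast at h2
    simpa using h2
  have := (G.lapMatrix_mulVec_eq_zero_iff_forall_reachable).1 h u v (hG.preconnected u v)
  exact_mod_cast this

/-! ### Dual simplices and the reflexivity criterion -/

theorem sum_dotProduct_smul_of_pairing {N d : ℕ} {V Y : Fin N → Fin d → ℝ}
    (h2 : ∀ k l, ∑ i, Y i k * V i l = if k = l then -(N : ℝ) else 0) (z : Fin d → ℝ) :
    ∑ i, (z ⬝ᵥ Y i) • V i = -(N : ℝ) • z := by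
  ext l
  simp only [Finset.sum_apply, Pi.smul_apply, smul_eq_mul, dotProduct, Finset.sum_mul]
  rw [Finset.sum_comm]
  simp_rw [mul_assoc, ← Finset.mul_sum, h2]
  simp [mul_comm]

/-- Points of `ℝ^d` that pair to `1 - N δ` with a dual family sum to zero. -/
theorem sum_eq_zero_of_pairing {N d : ℕ} (hN : 0 < N) {V Y : Fin N → Fin d → ℝ}
    (h1 : ∀ i j, V i ⬝ᵥ Y j = 1 - if i = j then (N : ℝ) else 0)
    (h2 : ∀ k l, ∑ i, Y i k * V i l = if k = l then -(N : ℝ) else 0) : ∑ i, V i = 0 := by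
  have hN' : (N : ℝ) ≠ 0 := by exact_mod_cast hN.ne'
  have h3 : ∀ j, (∑ i, V i) ⬝ᵥ Y j = 0 := fun j => by
    rw [sum_dotProduct]
    simp [h1]
  have h4 := sum_dotProduct_smul_of_pairing h2 (∑ i, V i)
  simp only [h3, zero_smul, Finset.sum_const_zero] at h4
  exact (smul_eq_zero.1 h4.symm).resolve_left (by simpa using hN')

/-- If two families of `N` points of `ℝ^d` pair to `1 - N δ`, then the convex hull of the first is
cut out by the inequalities given by the second. -/
theorem convexHull_range_eq_of_pairing {N d : ℕ} (hN : 0 < N) {V Y : Fin N → Fin d → ℝ}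
    (h1 : ∀ i j, V i ⬝ᵥ Y j = 1 - if i = j then (N : ℝ) else 0)
    (h2 : ∀ k l, ∑ i, Y i k * V i l = if k = l then -(N : ℝ) else 0) :
    convexHull ℝ (Set.range V) = {z | ∀ i, z ⬝ᵥ Y i ≤ 1} := by
  have hN' : (0 : ℝ) < N := by exact_mod_cast hN
  apply Set.Subset.antisymm
  · apply convexHull_min
    · rintro _ ⟨i, rfl⟩ j
      simp only [h1]
      split_ifs <;> linarith
    · have : {z : Fin d → ℝ | ∀ i, z ⬝ᵥ Y i ≤ 1} = ⋂ i, {z | z ⬝ᵥ Y i ≤ 1} := by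
        ext; simp
      rw [this]
      refine convex_iInter fun i => convex_halfSpace_le ⟨fun x y => ?_, fun c x => ?_⟩ 1
      · exact add_dotProduct _ _ _
      · exact smul_dotProduct _ _ _
  · intro z hz
    have hcolV : ∑ i, V i = 0 := sum_eq_zero_of_pairing hN h1 h2
    have hcol : ∑ i, Y i = 0 := by
      refine sum_eq_zero_of_pairing hN (Y := V) (fun i j => ?_) fun k l => ?_
      · rw [dotProduct_comm, h1]
        simp only [eq_comm]
      · rw [Finset.sum_congr rfl fun i _ => mul_comm (V i k) (Y i l), h2]
        simp only [eq_comm]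
    have hsum : ∑ i, z ⬝ᵥ Y i = 0 := by
      rw [← dotProduct_sum, hcol, dotProduct_zero]
    -- The barycentric coordinates of `z` are its slacks in the inequalities, divided by `N`.
    have hz' : z = ∑ i, ((1 - z ⬝ᵥ Y i) / N) • V i := by
      have h6 : ∀ i, ((1 - z ⬝ᵥ Y i) / N) • V i = (N : ℝ)⁻¹ • (V i - (z ⬝ᵥ Y i) • V i) := by
        intro i
        rw [div_eq_inv_mul, mul_smul, sub_smul, one_smul]
      simp_rw [h6, ← Finset.smul_sum, Finset.sum_sub_distrib, sum_dotProduct_smul_of_pairing h2,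
        hcolV]
      rw [zero_sub, neg_smul, neg_neg, inv_smul_smul₀ hN'.ne']
    rw [hz']
    refine (convex_convexHull ℝ _).sum_mem (fun i _ => ?_) ?_ fun i _ =>
      subset_convexHull ℝ _ ⟨i, rfl⟩
    · exact div_nonneg (sub_nonneg.2 (hz i)) hN'.le
    · rw [← Finset.sum_div, Finset.sum_sub_distrib, hsum]
      simp [hN'.ne']

/-- Subtracting its last value from a solution leaves its Laplacian unchanged and makes the deleted
column irrelevant. The resulting integral points are the vertices of the dual. -/
theorem isReflexive_laplacianSimplex {N : ℕ} {G : SimpleGraph (Fin N)} (hG : G.Connected)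
    (h : ∀ i, ∃ x : Fin N → ℤ, ∀ u, lap G x u = 1 - if u = i then (N : ℤ) else 0) :
    IsReflexive (laplacianSimplex G) := by
  classical
  obtain ⟨d, rfl⟩ : ∃ d, N = d + 1 :=
    Nat.exists_eq_succ_of_ne_zero fun h0 => by subst h0; exact hG.nonempty.some.elim0
  choose x hx using h
  have hV : ∀ (z : Fin (d + 1) → ℤ) (i),
      vertexMatrix G i ⬝ᵥ (fun j : Fin d => z j.castSucc - z (Fin.last d)) = lap G z i := by
    intro z i
    have h1 : lap G z = lap G (fun j => z j - z (Fin.last d)) := by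
      ext u; simp [lap_apply]
    rw [h1, ← lapMatrix_mulVec_eq_lap]
    simp only [Matrix.mulVec, dotProduct]
    rw [Fin.sum_univ_castSucc (n := d)]
    simp only [sub_self, mul_zero, add_zero]
    refine Finset.sum_congr rfl fun j _ => ?_
    simp only [vertexMatrix, laplacian]
    congr!
  let V : Fin (d + 1) → Fin d → ℤ := fun i => vertexMatrix G i
  let Y : Fin (d + 1) → Fin d → ℤ := fun i j => x i j.castSucc - x i (Fin.last d)
  have hVY : ∀ i k, V i ⬝ᵥ Y k = 1 - if i = k then ((d + 1 : ℕ) : ℤ) else 0 := fun i k => by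
    rw [← hx]; exact hV _ _
  have hcol : ∀ j, ∑ i, V i j = 0 := by
    intro j
    have h1 := congrFun (vecMul_laplacian_map G (fun _ => (1 : ℤ))) j.castSucc
    have h2 : lap G (fun _ => (1 : ℤ)) = 0 := by ext u; simp [lap_apply]
    rw [h2] at h1
    simp only [Matrix.vecMul, dotProduct, Matrix.map_apply, one_mul] at h1
    exact h1
  have hinj : ∀ w : Fin d → ℤ, (∀ i, V i ⬝ᵥ w = 0) → w = 0 := by
    intro w hw
    let z : Fin (d + 1) → ℤ := Fin.snoc w 0
    have hz : lap G z = 0 := by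
      ext i
      rw [← hV]
      have : (fun j : Fin d => z j.castSucc - z (Fin.last d)) = w := by
        ext j; simp [z]
      rw [this]
      exact hw i
    ext j
    simpa [z] using eq_of_lap_eq_zero hG hz j.castSucc (Fin.last d)
  have hYV : ∀ k l, ∑ i, Y i k * V i l = if k = l then -((d + 1 : ℕ) : ℤ) else 0 := by
    intro k l
    -- In matrix form, `V Yᵀ = J - N` and the zero column sums of `V` give `V (Yᵀ V + N) = 0`.
    -- Connectedness makes `V` injective, hence `Yᵀ V = -N`.
    have h0 := hinj (fun k => ∑ i, Y i k * V i l + if k = l then ((d + 1 : ℕ) : ℤ) else 0) (by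
      intro i
      have h3 : ∑ k, V i k * ∑ j, Y j k * V j l = ∑ j, (V i ⬝ᵥ Y j) * V j l := by
        simp_rw [dotProduct, Finset.sum_mul, Finset.mul_sum, mul_assoc]
        exact Finset.sum_comm
      simp only [dotProduct, mul_add, Finset.sum_add_distrib] at h3 ⊢
      rw [h3]
      have h4 : ∀ j, ∑ k, V i k * Y j k = 1 - if i = j then ((d + 1 : ℕ) : ℤ) else 0 :=
        fun j => hVY i j
      simp only [h4, sub_mul, Finset.sum_sub_distrib, one_mul, hcol, ite_mul, zero_mul, mul_ite,
        mul_zero, Finset.sum_ite_eq, Finset.sum_ite_eq', Finset.mem_univ, if_true]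
      ring)
    have h1 := congrFun h0 k
    simp only [Pi.zero_apply] at h1
    split_ifs at h1 ⊢ <;> linarith
  let VR : Fin (d + 1) → Fin d → ℝ := fun i j => V i j
  let YR : Fin (d + 1) → Fin d → ℝ := fun i j => Y i j
  have hP : ∀ i k, VR i ⬝ᵥ YR k = 1 - if i = k then ((d + 1 : ℕ) : ℝ) else 0 := by
    intro i k
    have := congrArg (Int.cast : ℤ → ℝ) (hVY i k)
    simp only [dotProduct] at this ⊢
    push_cast at this
    rw [this]
    push_cast
    rfl
  have hP' : ∀ i k, YR i ⬝ᵥ VR k = 1 - if i = k then ((d + 1 : ℕ) : ℝ) else 0 := by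
    intro i k
    rw [dotProduct_comm, hP]
    simp only [eq_comm]
  have hQ : ∀ k l, ∑ i, YR i k * VR i l = if k = l then -((d + 1 : ℕ) : ℝ) else 0 := by
    intro k l
    have := congrArg (Int.cast : ℤ → ℝ) (hYV k l)
    push_cast at this ⊢
    exact this
  have hQ' : ∀ k l, ∑ i, VR i k * YR i l = if k = l then -((d + 1 : ℕ) : ℝ) else 0 := by
    intro k l
    rw [Finset.sum_congr rfl fun i _ => mul_comm (VR i k) (YR i l), hQ]
    simp only [eq_comm]
  have hull := convexHull_range_eq_of_pairing d.succ_pos hP hQ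
  have hull' := convexHull_range_eq_of_pairing d.succ_pos hP' hQ'
  have hPdef : laplacianSimplex G = convexHull ℝ (Set.range VR) := rfl
  have hlat : ∀ W : Fin (d + 1) → Fin d → ℤ,
      IsLatticePolytope (convexHull ℝ (Set.range fun i j => (W i j : ℝ))) := by
    intro W
    refine ⟨Finset.univ.image W, ?_⟩
    congr 1
    ext z
    simp only [Set.mem_range, Finset.coe_image, Finset.coe_univ, Set.image_univ, Set.mem_image,
      exists_exists_eq_and]
  refine ⟨hPdef ▸ hlat V, ?_, ?_⟩
  · rw [hPdef, hull, mem_interior]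
    refine ⟨⋂ i, {z | z ⬝ᵥ YR i < 1}, fun z hz i => (Set.mem_iInter.1 hz i).le, ?_, ?_⟩
    · refine isOpen_iInter_of_finite fun i => isOpen_lt ?_ continuous_const
      unfold dotProduct
      fun_prop
    · simp
  · have : dualPolytope (laplacianSimplex G) = convexHull ℝ (Set.range YR) := by
      rw [hull', hPdef]
      ext z
      refine ⟨fun hz i => hz _ (subset_convexHull ℝ _ ⟨i, rfl⟩), fun hz => ?_⟩
      refine convexHull_min (s := Set.range VR) (t := {y | z ⬝ᵥ y ≤ 1}) ?_
        (convex_halfSpace_le ⟨fun x y => ?_, fun c x => ?_⟩ 1)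
      · rintro _ ⟨i, rfl⟩
        exact hz i
      · exact dotProduct_add _ _ _
      · exact dotProduct_smul _ _ _
    rw [this]
    exact hlat Y

/-! ### Bridges of graphs -/

/-- Vertex `k` of the `j`-th block of a bridge. -/
def vtx {b n : ℕ} (j : Fin b) (k : Fin n) : Fin (b * n) := finProdFinEquiv (j, k)

@[simp] theorem divNat_vtx {b n : ℕ} (j : Fin b) (k : Fin n) : (vtx j k).divNat = j :=
  congrArg Prod.fst (finProdFinEquiv.symm_apply_apply (j, k))

@[simp] theorem modNat_vtx {b n : ℕ} (j : Fin b) (k : Fin n) : (vtx j k).modNat = k :=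
  congrArg Prod.snd (finProdFinEquiv.symm_apply_apply (j, k))

@[simp] theorem vtx_divNat_modNat {b n : ℕ} (v : Fin (b * n)) : vtx v.divNat v.modNat = v :=
  finProdFinEquiv.apply_symm_apply v

theorem vtx_inj {b n : ℕ} {j j' : Fin b} {k k' : Fin n} :
    vtx j k = vtx j' k' ↔ j = j' ∧ k = k' := by
  simp [vtx]

theorem val_vtx {b n : ℕ} (j : Fin b) (k : Fin n) : (vtx j k : ℕ) = k + n * j := rfl

theorem sum_vtx {b n : ℕ} {A : Type*} [AddCommMonoid A] (f : Fin (b * n) → A) :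
    ∑ v, f v = ∑ j, ∑ k, f (vtx j k) := by
  rw [← finProdFinEquiv.sum_comp, Fintype.sum_prod_type]
  rfl

theorem bridge_adj {b n : ℕ} {H : Fin b → SimpleGraph (Fin n)} {j j' : Fin b} {k k' : Fin n} :
    (bridge H).Adj (vtx j k) (vtx j' k') ↔
      (j = j' ∧ (H j).Adj k k') ∨ ((j : ℕ) + 1 = j' ∧ (k : ℕ) + 1 = n ∧ (k' : ℕ) = 0) ∨
        ((j' : ℕ) + 1 = j ∧ (k' : ℕ) + 1 = n ∧ (k : ℕ) = 0) := by
  simp only [bridge, SimpleGraph.fromRel_adj, divNat_vtx, modNat_vtx, ne_eq, vtx_inj]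
  constructor
  · rintro ⟨-, (⟨h, h'⟩ | h) | (⟨h, h'⟩ | h)⟩
    · exact Or.inl ⟨h, h'⟩
    · exact Or.inr (Or.inl h)
    · subst h
      exact Or.inl ⟨rfl, h'.symm⟩
    · exact Or.inr (Or.inr h)
  · rintro (⟨h, h'⟩ | h | h)
    · exact ⟨fun h2 => h'.ne h2.2, Or.inl (Or.inl ⟨h, h'⟩)⟩
    · exact ⟨fun h2 => by rw [h2.1] at h; omega, Or.inl (Or.inr h)⟩
    · exact ⟨fun h2 => by rw [h2.1] at h; omega, Or.inr (Or.inr h)⟩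

/-- Where a function does not vary along the bridging edges, its Laplacian is computed blockwise. -/
theorem lap_bridge_apply {b n : ℕ} {A : Type*} [AddCommGroup A] {H : Fin b → SimpleGraph (Fin n)}
    {x : Fin (b * n) → A} {j : Fin b} {k : Fin n}
    (hx : ∀ j' k', j' ≠ j → (bridge H).Adj (vtx j k) (vtx j' k') → x (vtx j k) = x (vtx j' k')) :
    lap (bridge H) x (vtx j k) = lap (H j) (fun k' => x (vtx j k')) k := by
  classical
  rw [lap_apply, sum_vtx, Finset.sum_eq_single j, lap_apply]
  · refine Finset.sum_congr rfl fun k' _ => if_congr ?_ rfl rfl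
    rw [bridge_adj]
    simp
  · intro j' _ hj
    refine Finset.sum_eq_zero fun k' _ => ?_
    split_ifs with h
    · rw [hx j' k' hj h, sub_self]
    · rfl
  · simp

theorem bridge_connected {b n : ℕ} (hb : 0 < b) (hn : 0 < n) {H : Fin b → SimpleGraph (Fin n)}
    (hH : ∀ j, SimpleGraph.pathGraph n ≤ H j) : (bridge H).Connected := by
  have hpos : 0 < b * n := Nat.mul_pos hb hn
  have hle : SimpleGraph.pathGraph (b * n) ≤ bridge H := by
    have key : ∀ u v : Fin (b * n), (u : ℕ) + 1 = v → (bridge H).Adj u v := by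
      intro u v huv
      rw [← vtx_divNat_modNat u, ← vtx_divNat_modNat v] at huv ⊢
      generalize u.divNat = j at *
      generalize u.modNat = k at *
      generalize v.divNat = j' at *
      generalize v.modNat = k' at *
      rw [val_vtx, val_vtx] at huv
      rw [bridge_adj]
      have hk := k.2
      have hk' := k'.2
      rcases lt_trichotomy (j : ℕ) j' with h | h | h
      -- Consecutive indices in different blocks must be a last vertex followed by a first one.
      · have h1 : n * (j + 1) ≤ n * j' := Nat.mul_le_mul_left _ h
        rw [mul_add] at h1
        have h2 : (k : ℕ) + 1 = n ∧ (k' : ℕ) = 0 := by omega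
        refine Or.inr (Or.inl ⟨?_, h2⟩)
        have h3 : n * (j + 1) = n * j' := by rw [mul_add]; omega
        exact Nat.eq_of_mul_eq_mul_left hn h3
      · refine Or.inl ⟨Fin.ext h, hH j ?_⟩
        rw [SimpleGraph.pathGraph_adj]
        rw [h] at huv
        omega
      · have h1 : n * (j' + 1) ≤ n * j := Nat.mul_le_mul_left _ h
        rw [mul_add] at h1
        omega
    intro u v huv
    rw [SimpleGraph.pathGraph_adj] at huv
    rcases huv with h | h
    · exact key u v h
    · exact (key v u h).symm
  have : Nonempty (Fin (b * n)) := ⟨⟨0, hpos⟩⟩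
  exact ⟨(SimpleGraph.pathGraph_preconnected _).mono hle⟩

/-- The Laplacian image of one block, extended by zero, lies in the Laplacian image of a bridge. -/
theorem block_mem_range_lap {b m : ℕ} {A : Type*} [AddCommGroup A]
    (H : Fin b → SimpleGraph (Fin (m + 1))) (j : Fin b) (g : Fin (m + 1) → A) :
    (fun v : Fin (b * (m + 1)) => if v.divNat = j then lap (H j) g v.modNat else 0) ∈
      (lap (A := A) (bridge H)).range := by
  -- Extending `g` by its end values on either side makes it constant along every bridging edge.
  refine ⟨fun v => if v.divNat < j then g 0 else if v.divNat = j then g v.modNat else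
    g (Fin.last m), ?_⟩
  ext v
  rw [← vtx_divNat_modNat v]
  generalize v.divNat = i
  generalize v.modNat = k
  rw [lap_bridge_apply]
  · simp only [divNat_vtx, modNat_vtx]
    by_cases hij : i = j
    · subst hij
      simp
    · simp only [hij, if_false]
      rw [lap_apply]
      simp
  · intro j' k' hne hadj
    simp only [divNat_vtx, modNat_vtx]
    rw [bridge_adj] at hadj
    have h0 : ∀ k : Fin (m + 1), (k : ℕ) = 0 → k = 0 := fun k h => Fin.ext h
    have h1 : ∀ k : Fin (m + 1), (k : ℕ) + 1 = m + 1 → k = Fin.last m := fun k h =>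
      Fin.ext (by simpa using h)
    rcases hadj with h | ⟨h, h2, h3⟩ | ⟨h, h2, h3⟩
    · exact absurd h.1.symm hne
    · rw [h1 k h2, h0 k' h3]
      simp only [Fin.lt_def, Fin.ext_iff]
      split_ifs <;> first | rfl | omega
    · rw [h1 k' h2, h0 k h3]
      simp only [Fin.lt_def, Fin.ext_iff]
      split_ifs <;> first | rfl | omega

/-- The difference of the endpoints of a bridging edge lies in the image of the Laplacian. -/
theorem bridging_edge_mem_range_lap {b m : ℕ} (H : Fin b → SimpleGraph (Fin (m + 1)))
    {j j' : Fin b} (hj : (j : ℕ) + 1 = j') :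
    (Pi.single (vtx j (Fin.last m)) 1 - Pi.single (vtx j' 0) 1 : Fin (b * (m + 1)) → ℤ) ∈
      (lap (A := ℤ) (bridge H)).range := by
  classical
  -- This indicator jumps along one edge only, the bridging edge after block `j`.
  refine ⟨fun v => if v.divNat ≤ j then 1 else 0, ?_⟩
  have h0 : ∀ k : Fin (m + 1), (k : ℕ) = 0 ↔ k = 0 := fun k => by
    rw [Fin.ext_iff, Fin.val_zero]
  have h1 : ∀ k : Fin (m + 1), (k : ℕ) + 1 = m + 1 ↔ k = Fin.last m := fun k => by
    rw [Fin.ext_iff, Fin.val_last, Nat.add_right_cancel_iff]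
  ext v
  rw [← vtx_divNat_modNat v]
  generalize v.divNat = i
  generalize v.modNat = k
  have hterm : ∀ i' k', (if (bridge H).Adj (vtx i k) (vtx i' k') then
      (if i ≤ j then (1 : ℤ) else 0) - (if i' ≤ j then 1 else 0) else 0) =
      (if i = j ∧ k = Fin.last m then (if i' = j' ∧ k' = 0 then 1 else 0) else 0) -
      (if i = j' ∧ k = 0 then (if i' = j ∧ k' = Fin.last m then 1 else 0) else 0) := by
    intro i' k'
    rw [bridge_adj, h0, h0, h1, h1]
    simp only [Fin.ext_iff (a := i), Fin.ext_iff (a := i'), Fin.le_def]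
    by_cases e : (i : ℕ) = i'
    · rw [← e]
      split_ifs <;> first | rfl | omega
    · split_ifs <;> first | rfl | omega
  rw [lap_apply, sum_vtx]
  simp only [divNat_vtx, hterm]
  simp only [Finset.sum_sub_distrib, Pi.sub_apply, Pi.single_apply, vtx_inj]
  congr 1
  · split_ifs with h
    · simp [ite_and]
    · simp
  · split_ifs with h
    · simp [ite_and]
    · simp

/-- Laplacian simplices of bridges: solvability of `L x = 1 - n e_k` passes from blocks to
the bridge. -/
theorem exists_lap_bridge_eq {b m : ℕ} {H : Fin b → SimpleGraph (Fin (m + 1))}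
    (hH : ∀ j k, ∃ g : Fin (m + 1) → ℤ,
      ∀ u, lap (H j) g u = 1 - if u = k then ((m + 1 : ℕ) : ℤ) else 0)
    (i : Fin (b * (m + 1))) :
    ∃ x : Fin (b * (m + 1)) → ℤ,
      ∀ u, lap (bridge H) x u = 1 - if u = i then ((b * (m + 1) : ℕ) : ℤ) else 0 := by
  classical
  set I := (lap (A := ℤ) (bridge H)).range
  -- With `n = m + 1`, `E j` is the indicator of block `j` and `S v = n e_v`. Modulo the image `I`,
  -- `E j` is congruent to `S v` for `v` in block `j`, and the bridging edges make all `S v`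
  -- congruent.
  let E : Fin b → Fin (b * (m + 1)) → ℤ := fun j v => if v.divNat = j then 1 else 0
  let S : Fin (b * (m + 1)) → Fin (b * (m + 1)) → ℤ := fun v => Pi.single v ((m + 1 : ℕ) : ℤ)
  have hE : ∀ j k, E j - S (vtx j k) ∈ I := by
    intro j k
    obtain ⟨g, hg⟩ := hH j k
    have := block_mem_range_lap H j g
    convert this using 1
    ext v
    rw [← vtx_divNat_modNat v]
    simp only [Pi.sub_apply, E, S, divNat_vtx, modNat_vtx, hg, Pi.single_apply, vtx_inj, ite_and]
    split_ifs <;> rfl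
  have hblock : ∀ j k k', S (vtx j k) - S (vtx j k') ∈ I := by
    intro j k k'
    have := I.sub_mem (hE j k') (hE j k)
    simpa using this
  have hstep : ∀ j j' : Fin b, (j : ℕ) + 1 = j' → S (vtx j (Fin.last m)) - S (vtx j' 0) ∈ I := by
    intro j j' h
    have := I.zsmul_mem (bridging_edge_mem_range_lap H h) ((m + 1 : ℕ) : ℤ)
    convert this using 1
    ext v
    simp [S, Pi.single_apply, mul_sub]
  have hb : 0 < b := Nat.pos_of_mul_pos_right (i.pos)
  have hall : ∀ (j : ℕ) (hj : j < b) (k), S (vtx ⟨j, hj⟩ k) - S (vtx ⟨0, hb⟩ 0) ∈ I := by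
    intro j
    induction j with
    | zero => exact fun _ k => hblock _ _ _
    | succ j ih =>
      intro hj k
      have h1 := ih (by omega) (Fin.last m)
      have h2 := hstep ⟨j, by omega⟩ ⟨j + 1, hj⟩ rfl
      have h3 := hblock ⟨j + 1, hj⟩ k 0
      have := I.add_mem (I.sub_mem h3 h2) h1
      convert this using 1
      abel
  have hall' : ∀ u v, S u - S v ∈ I := by
    intro u v
    have hu := hall u.divNat u.divNat.2 u.modNat
    have hv := hall v.divNat v.divNat.2 v.modNat
    simp only [Fin.eta, vtx_divNat_modNat] at hu hv
    simpa using I.sub_mem hu hv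
  -- The sum telescopes to `∑ E j - b S i`, which is `1 - b n e_i`.
  have hfin : ∑ j, ((E j - S (vtx j 0)) + (S (vtx j 0) - S i)) ∈ I :=
    I.sum_mem fun j _ => I.add_mem (hE j 0) (hall' _ _)
  obtain ⟨x, hx⟩ := hfin
  refine ⟨x, fun u => ?_⟩
  rw [hx]
  simp only [sub_add_sub_cancel, Finset.sum_sub_distrib, Finset.sum_const, Finset.card_univ,
    Fintype.card_fin, Pi.sub_apply, Finset.sum_apply, E, S, Pi.single_apply]
  simp

/-! ### Complete graphs, odd cycles and reflexivity of the family -/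

theorem lap_top_apply {V A : Type*} [Fintype V] [AddCommGroup A] (x : V → A) (u : V) :
    lap ⊤ x u = Fintype.card V • x u - ∑ v, x v := by
  classical
  rw [lap_apply, ← Finset.card_univ, ← Finset.sum_const, ← Finset.sum_sub_distrib]
  refine Finset.sum_congr rfl fun v _ => ?_
  by_cases h : u = v
  · subst h; simp
  · simp [h]

theorem exists_lap_top_eq {n : ℕ} (k : Fin n) :
    ∃ g : Fin n → ℤ, ∀ u, lap ⊤ g u = 1 - if u = k then (n : ℤ) else 0 := by
  refine ⟨Pi.single k (-1), fun u => ?_⟩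
  rw [lap_top_apply]
  simp only [Pi.single_apply, Fintype.card_fin, Finset.sum_ite_eq', Finset.mem_univ, if_true]
  split_ifs
  · simp
    ring
  · simp

theorem lap_cycleGraph_apply {m : ℕ} {A : Type*} [AddCommGroup A] (x : Fin (m + 3) → A)
    (u : Fin (m + 3)) :
    lap (SimpleGraph.cycleGraph (m + 3)) x u = (x u - x (u - 1)) + (x u - x (u + 1)) := by
  classical
  have h : lap (SimpleGraph.cycleGraph (m + 3)) x u =
      ∑ v ∈ (SimpleGraph.cycleGraph (m + 3)).neighborFinset u, (x u - x v) := by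
    rw [SimpleGraph.neighborFinset_eq_filter, Finset.sum_filter, lap_apply]
    congr!
  have : (SimpleGraph.cycleGraph (m + 3)).neighborFinset u = {u - 1, u + 1} := by
    rw [← SimpleGraph.cycleGraph_neighborFinset]
  rw [h, this, Finset.sum_pair]
  simp only [ne_eq, sub_eq_iff_eq_add, add_assoc u, left_eq_add]
  exact ne_of_beq_false rfl

/-- The quadratic `d (n - d) / 2` has negative second difference `1` and vanishes at `0` and `n`, so
it closes up around the cycle with a kink only at `0`. For odd `n` one factor of `d (n - d)` is
even. -/
theorem exists_lap_cycleGraph_eq {m : ℕ} (hm : Odd (m + 3)) (k : Fin (m + 3)) :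
    ∃ g : Fin (m + 3) → ℤ, ∀ u,
      lap (SimpleGraph.cycleGraph (m + 3)) g u = 1 - if u = k then ((m + 3 : ℕ) : ℤ) else 0 := by
  let h : Fin (m + 3) → ℤ := fun d => (d : ℤ) * ((m + 3 : ℕ) - (d : ℤ)) / 2
  have h2 : ∀ d, 2 * h d = (d : ℤ) * ((m + 3 : ℕ) - (d : ℤ)) := by
    intro d
    refine Int.mul_ediv_cancel' ?_
    obtain ⟨r, hr⟩ := hm
    have hr' : ((m + 3 : ℕ) : ℤ) = 2 * r + 1 := by exact_mod_cast hr
    rw [hr']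
    rcases Int.even_or_odd' (d : ℤ) with ⟨c, hc | hc⟩
    · exact Dvd.dvd.mul_right ⟨c, hc⟩ _
    · refine Dvd.dvd.mul_left ⟨r - c, ?_⟩ _
      rw [hc]; ring
  refine ⟨fun u => h (u - k), fun u => ?_⟩
  rw [lap_cycleGraph_apply]
  have e1 : u - 1 - k = (u - k) - 1 := by abel
  have e2 : u + 1 - k = (u - k) + 1 := by abel
  have e3 : u = k ↔ u - k = 0 := sub_eq_zero.symm
  simp only [e1, e2, e3]
  generalize u - k = d
  have key : 2 * ((h d - h (d - 1)) + (h d - h (d + 1))) =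
      2 * (1 - if d = 0 then ((m + 3 : ℕ) : ℤ) else 0) := by
    have : 2 * ((h d - h (d - 1)) + (h d - h (d + 1))) =
      2 * (2 * h d) - 2 * h (d - 1) - 2 * h (d + 1) := by ring
    rw [this, h2, h2, h2]
    by_cases h0 : d = 0
    · subst h0
      have h3 : ((0 - 1 : Fin (m + 3)) : ℕ) = m + 2 := by simp
      have h4 : ((0 + 1 : Fin (m + 3)) : ℕ) = 1 := by simp
      rw [h3, h4]
      simp only [Fin.val_zero, if_true]
      push_cast
      ring
    · have h3 : ((d - 1 : Fin (m + 3)) : ℕ) = d - 1 := Fin.val_sub_one_of_ne_zero h0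
      have hd : 1 ≤ (d : ℕ) := Nat.one_le_iff_ne_zero.2 fun h => h0 (Fin.ext h)
      rw [h3, if_neg h0, Fin.val_add_one, Nat.cast_sub hd]
      -- At the last vertex `d + 1` wraps to `0`, where the quadratic has the same value as at `n`.
      split_ifs with hl
      · rw [hl]
        simp only [Fin.val_last]
        push_cast
        ring
      · push_cast
        ring
  linarith

theorem cycleCompleteBridge_connected {a b n : ℕ} (hb : 0 < b) (hn : 0 < n) :
    (cycleCompleteBridge a b n).Connected := by
  refine bridge_connected hb hn fun j => ?_
  split_ifs
  · exact SimpleGraph.pathGraph_le_cycleGraph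
  · exact le_top

theorem isReflexive_cycleCompleteBridge {a b n : ℕ} (hb : 0 < b) (hn : Odd n) (hn3 : 3 ≤ n) :
    IsReflexive (laplacianSimplex (cycleCompleteBridge a b n)) := by
  obtain ⟨m, rfl⟩ := Nat.exists_eq_add_of_le' hn3
  refine isReflexive_laplacianSimplex (cycleCompleteBridge_connected hb (by omega))
    (exists_lap_bridge_eq fun j k => ?_)
  split_ifs
  · exact exists_lap_cycleGraph_eq hn k
  · exact exists_lap_top_eq k

/-! ### Upper bound for the code -/

/-- By symmetry `x L = L x`; the equation lost at the last vertex is replaced by the zero-sum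
condition. -/
theorem mem_code_iff {N : ℕ} (hN : 0 < N) {G : SimpleGraph (Fin N)} {x : Fin N → ZMod N} :
    x ∈ code G ↔ (∀ j : Fin N, (j : ℕ) + 1 < N → lap G x j = 0) ∧ ∑ i, x i = 0 := by
  have h : ∀ j, (x ᵥ* (augmentedMatrix G).map (Int.cast : ℤ → ZMod N)) j =
      if (j : ℕ) + 1 < N then lap G x j else ∑ i, x i := by
    intro j
    rw [← vecMul_laplacian_map]
    simp only [Matrix.vecMul, dotProduct, Matrix.map_apply, augmentedMatrix]
    split_ifs
    · rfl
    · simp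
  rw [code, LinearMap.mem_ker, Matrix.vecMulLinear_apply, funext_iff]
  simp only [h, Pi.zero_apply]
  constructor
  · intro hx
    refine ⟨fun j hj => by simpa [hj] using hx j, ?_⟩
    have := hx ⟨N - 1, by omega⟩
    rwa [if_neg (by simp only; omega)] at this
  · rintro ⟨h1, h2⟩ j
    split_ifs with hj
    · exact h1 j hj
    · exact h2

/-- In `ℤ/bn` the `n`-torsion consists of multiples of `b`. -/
theorem eq_mul_of_nsmul_eq_zero {b n : ℕ} (hn : 0 < n) [NeZero (b * n)] {y : ZMod (b * n)}
    (hy : n • y = 0) : y = ((b * (y.val / b) : ℕ) : ZMod (b * n)) := by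
  have h1 : ((n * y.val : ℕ) : ZMod (b * n)) = 0 := by
    rw [Nat.cast_mul, ZMod.natCast_zmod_val, ← nsmul_eq_mul, hy]
  rw [ZMod.natCast_eq_zero_iff] at h1
  have h2 : b ∣ y.val := Nat.dvd_of_mul_dvd_mul_left hn ((Nat.mul_comm n b).dvd.trans h1)
  rw [Nat.mul_div_cancel' h2, ZMod.natCast_zmod_val]

theorem lap_bridge_apply_of_interior {b n : ℕ} {A : Type*} [AddCommGroup A]
    {H : Fin b → SimpleGraph (Fin n)} (x : Fin (b * n) → A) {j : Fin b} {k : Fin n}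
    (hk : 0 < (k : ℕ)) (hk' : (k : ℕ) + 1 < n) :
    lap (bridge H) x (vtx j k) = lap (H j) (fun k' => x (vtx j k')) k := by
  refine lap_bridge_apply fun j' k' hne hadj => ?_
  rw [bridge_adj] at hadj
  rcases hadj with h | h | h
  · exact absurd h.1.symm hne
  · omega
  · omega

theorem card_code_le {a b m : ℕ} (hab : a ≤ b) (hb : 0 < b) :
    Nat.card (code (cycleCompleteBridge a b (m + 3))) ≤
      (b * (m + 3)) ^ (3 * b + a * (m + 3)) := by
  have hN : 0 < b * (m + 3) := by positivity
  have : NeZero (b * (m + 3)) := ⟨hN.ne'⟩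
  let one : Fin (m + 3) := ⟨1, by omega⟩
  let blk : Fin a → Fin b := fun i => ⟨i + (b - a), by omega⟩
  -- Three symbols per block are recorded, and for complete blocks the differences from the interior
  -- vertex `one`, divided by `b`. At interior vertices these differences are multiples of `b`, so
  -- the quotients lose nothing.
  let Φ : code (cycleCompleteBridge a b (m + 3)) →
      (Fin b → Fin 3 → ZMod (b * (m + 3))) × (Fin a → Fin (m + 3) → Fin (m + 3)) := fun x =>
    (fun j => ![x.1 (vtx j 0), x.1 (vtx j one), x.1 (vtx j (Fin.last _))],
      fun i k => ⟨(x.1 (vtx (blk i) k) - x.1 (vtx (blk i) one)).val / b,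
        Nat.div_lt_of_lt_mul (ZMod.val_lt _)⟩)
  have hint : ∀ (x : code (cycleCompleteBridge a b (m + 3))) (j : Fin b) (k : Fin (m + 3)),
      0 < (k : ℕ) → (k : ℕ) < m + 2 →
      lap (if (j : ℕ) < b - a then SimpleGraph.cycleGraph (m + 3) else ⊤)
        (fun k' => x.1 (vtx j k')) k = 0 := by
    intro x j k hk hk'
    have h1 := ((mem_code_iff hN).1 x.2).1 (vtx j k) (by
      rw [val_vtx]
      have : (m + 3) * (j + 1) ≤ (m + 3) * b := Nat.mul_le_mul_left _ j.2
      rw [mul_add] at this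
      rw [mul_comm b]
      omega)
    exact (lap_bridge_apply_of_interior (H := fun j : Fin b =>
      if (j : ℕ) < b - a then SimpleGraph.cycleGraph (m + 3) else ⊤) x.1 hk
        (by omega)).symm.trans h1
  have hinj : Function.Injective Φ := by
    intro x y hxy
    have hp : ∀ j, x.1 (vtx j 0) = y.1 (vtx j 0) ∧ x.1 (vtx j one) = y.1 (vtx j one) ∧
        x.1 (vtx j (Fin.last _)) = y.1 (vtx j (Fin.last _)) := by
      intro j
      have h := congrFun (congrArg Prod.fst hxy) j
      exact ⟨congrFun h 0, congrFun h 1, congrFun h 2⟩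
    have hq : ∀ i k, (x.1 (vtx (blk i) k) - x.1 (vtx (blk i) one)).val / b =
        (y.1 (vtx (blk i) k) - y.1 (vtx (blk i) one)).val / b := fun i k =>
      congrArg Fin.val (congrFun (congrFun (congrArg Prod.snd hxy) i) k)
    ext v
    rw [← vtx_divNat_modNat v]
    generalize v.divNat = j
    generalize v.modNat = k
    by_cases hj : (j : ℕ) < b - a
    -- On a cycle, the equation at `k + 1` determines the entry at `k + 2` from the two before it.
    · have key : ∀ (k : ℕ) (hk : k < m + 3), x.1 (vtx j ⟨k, hk⟩) = y.1 (vtx j ⟨k, hk⟩) := by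
        intro k
        induction k using Nat.strong_induction_on with
        | _ k ih =>
          intro hk
          match k with
          | 0 => exact (hp j).1
          | 1 => exact (hp j).2.1
          | k + 2 =>
            have e1 : (⟨k + 1, by omega⟩ : Fin (m + 3)) - 1 = ⟨k, by omega⟩ := by
              ext
              rw [Fin.val_sub_one_of_ne_zero (by simp [Fin.ext_iff])]
              simp
            have e2 : (⟨k + 1, by omega⟩ : Fin (m + 3)) + 1 = ⟨k + 2, hk⟩ := by
              ext
              rw [Fin.val_add_one, if_neg (by rw [Fin.ext_iff, Fin.val_last]; simp only; omega)]
            have hx := hint x j ⟨k + 1, by omega⟩ (by simp) (by simp only; omega)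
            have hy := hint y j ⟨k + 1, by omega⟩ (by simp) (by simp only; omega)
            rw [if_pos hj, lap_cycleGraph_apply, e1, e2] at hx hy
            rw [ih k (by omega) (by omega), ih (k + 1) (by omega) (by omega)] at hx
            have := hx.trans hy.symm
            simpa using this
      exact key k k.2
    -- On a complete block, the equations at `k` and `one` equate both `n z_k` and `n z_one` with
    -- the block sum.
    · have htor : ∀ (z : code (cycleCompleteBridge a b (m + 3))), 0 < (k : ℕ) →
          (k : ℕ) < m + 2 → (m + 3) • (z.1 (vtx j k) - z.1 (vtx j one)) = 0 := by
        intro z h1 h2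
        have hz := hint z j k h1 h2
        have hz' := hint z j one (by simp [one]) (by simp [one])
        rw [if_neg hj, lap_top_apply, Fintype.card_fin] at hz hz'
        rw [smul_sub, sub_eq_zero.1 hz, sub_eq_zero.1 hz', sub_self]
      rcases Nat.eq_zero_or_pos (k : ℕ) with h0 | h0
      · rw [show k = 0 from Fin.ext h0]
        exact (hp j).1
      rcases Nat.lt_or_ge (k : ℕ) (m + 2) with h2 | h2
      · have hbk : blk ⟨j - (b - a), by omega⟩ = j := Fin.ext (by simp only [blk]; omega)
        have h3 := hq ⟨j - (b - a), by omega⟩ k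
        rw [hbk] at h3
        have h4 := eq_mul_of_nsmul_eq_zero (by omega) (htor x h0 h2)
        rw [h3, ← eq_mul_of_nsmul_eq_zero (by omega) (htor y h0 h2), (hp j).2.1] at h4
        exact sub_left_injective h4
      · rw [show k = Fin.last _ from Fin.ext (by rw [Fin.val_last]; omega)]
        exact (hp j).2.2
  refine (Nat.card_le_card_of_injective Φ hinj).trans ?_
  simp only [Nat.card_eq_fintype_card, Fintype.card_prod, Fintype.card_pi, Finset.prod_const,
    Finset.card_univ, Fintype.card_fin, ZMod.card]
  rw [pow_add (b * (m + 3)), ← pow_mul, ← pow_mul, mul_comm (m + 3) a]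
  gcongr
  exact Nat.le_mul_of_pos_left _ hb

/-! ### Lower bound for the code -/

/-- A word on `m + 3` letters vanishing at both ends and summing to zero, with prescribed
entries `b t` at the places `2, …, m + 1`. -/
def balancedWord {b m : ℕ} (t : Fin m → Fin (m + 3)) : Fin (m + 3) → ZMod (b * (m + 3)) :=
  Fin.cons 0 (Fin.cons (-∑ i, ((b * t i : ℕ) : ZMod (b * (m + 3))))
    (Fin.snoc (fun i => ((b * t i : ℕ) : ZMod (b * (m + 3)))) 0))

theorem balancedWord_zero {b m : ℕ} (t : Fin m → Fin (m + 3)) :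
    balancedWord (b := b) t 0 = 0 := rfl

theorem balancedWord_last {b m : ℕ} (t : Fin m → Fin (m + 3)) :
    balancedWord (b := b) t (Fin.last _) = 0 := by
  rw [balancedWord, ← Fin.succ_last, Fin.cons_succ, ← Fin.succ_last, Fin.cons_succ, Fin.snoc_last]

theorem balancedWord_castSucc {b m : ℕ} (t : Fin m → Fin (m + 3)) (i : Fin m) :
    balancedWord (b := b) t i.castSucc.succ.succ = ((b * t i : ℕ) : ZMod (b * (m + 3))) := by
  rw [balancedWord, Fin.cons_succ, Fin.cons_succ, Fin.snoc_castSucc]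

theorem sum_balancedWord {b m : ℕ} (t : Fin m → Fin (m + 3)) :
    ∑ k, balancedWord (b := b) t k = 0 := by
  rw [balancedWord, Fin.sum_cons, Fin.sum_cons, Fin.sum_snoc]
  simp

theorem nsmul_balancedWord {b m : ℕ} (t : Fin m → Fin (m + 3)) (k : Fin (m + 3)) :
    (m + 3) • balancedWord (b := b) t k = 0 := by
  have h : ∀ s : ℕ, (m + 3) • ((b * s : ℕ) : ZMod (b * (m + 3))) = 0 := by
    intro s
    rw [nsmul_eq_mul, ← Nat.cast_mul, ZMod.natCast_eq_zero_iff]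
    exact ⟨s, by ring⟩
  induction k using Fin.cases with
  | zero => rw [balancedWord_zero, smul_zero]
  | succ k =>
    rw [balancedWord, Fin.cons_succ]
    induction k using Fin.cases with
    | zero =>
      rw [Fin.cons_zero, smul_neg, Finset.smul_sum]
      simp only [h, Finset.sum_const_zero, neg_zero]
    | succ k =>
      rw [Fin.cons_succ]
      induction k using Fin.lastCases with
      | last => rw [Fin.snoc_last, smul_zero]
      | cast i => rw [Fin.snoc_castSucc, h]

theorem balancedWord_injective {b m : ℕ} (hb : 0 < b) :
    Function.Injective (balancedWord (b := b) (m := m)) := by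
  intro t t' h
  ext i
  have h1 := congrFun h i.castSucc.succ.succ
  rw [balancedWord_castSucc, balancedWord_castSucc] at h1
  have h2 := congrArg ZMod.val h1
  rw [ZMod.val_natCast, ZMod.val_natCast,
    Nat.mod_eq_of_lt (Nat.mul_lt_mul_of_pos_left (t i).2 hb),
    Nat.mod_eq_of_lt (Nat.mul_lt_mul_of_pos_left (t' i).2 hb)] at h2
  exact Nat.eq_of_mul_eq_mul_left hb h2

/-- Each complete block carries a balanced word with `n - 3` free entries, and each cycle carries
zero. Vanishing at block ends decouples the blocks; on `K_n` the Laplacian is `n x - ∑ x`, which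
kills zero-sum `n`-torsion. -/
theorem le_card_code {a b m : ℕ} (hab : a ≤ b) (hb : 0 < b) :
    (m + 3) ^ (m * a) ≤ Nat.card (code (cycleCompleteBridge a b (m + 3))) := by
  have hN : 0 < b * (m + 3) := by positivity
  have : NeZero (b * (m + 3)) := ⟨hN.ne'⟩
  let f : (Fin a → Fin m → Fin (m + 3)) → Fin b → Fin (m + 3) → ZMod (b * (m + 3)) := fun t j =>
    if h : (j : ℕ) < b - a then 0 else balancedWord (t ⟨j - (b - a), by omega⟩)
  have f_zero : ∀ t j, f t j 0 = 0 := fun t j => by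
    simp only [f]
    split_ifs
    · rfl
    · exact balancedWord_zero _
  have f_last : ∀ t j, f t j (Fin.last _) = 0 := fun t j => by
    simp only [f]
    split_ifs
    · rfl
    · exact balancedWord_last _
  have f_sum : ∀ t j, ∑ k, f t j k = 0 := fun t j => by
    simp only [f]
    split_ifs
    · simp
    · exact sum_balancedWord _
  have hmem : ∀ t, (fun v => f t v.divNat v.modNat) ∈ code (cycleCompleteBridge a b (m + 3)) := by
    intro t
    refine (mem_code_iff hN).2 ⟨fun v _ => ?_, ?_⟩
    · rw [← vtx_divNat_modNat v, cycleCompleteBridge]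
      generalize v.divNat = j
      generalize v.modNat = k
      rw [lap_bridge_apply]
      · simp only [divNat_vtx, modNat_vtx]
        by_cases hj : (j : ℕ) < b - a
        · have : (fun k => f t j k) = 0 := by
            ext k
            simp [f, hj]
          rw [this, map_zero, Pi.zero_apply]
        · rw [if_neg hj, lap_top_apply, f_sum, sub_zero, Fintype.card_fin]
          simp only [f, dif_neg hj]
          exact nsmul_balancedWord _ _
      · intro j' k' hne hadj
        rw [bridge_adj] at hadj
        have h0 : ∀ k : Fin (m + 3), (k : ℕ) = 0 → k = 0 := fun k h => Fin.ext h
        have h1 : ∀ k : Fin (m + 3), (k : ℕ) + 1 = m + 3 → k = Fin.last _ := fun k h =>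
          Fin.ext (by rw [Fin.val_last]; omega)
        simp only [divNat_vtx, modNat_vtx]
        rcases hadj with h | ⟨-, h2, h3⟩ | ⟨-, h2, h3⟩
        · exact absurd h.1.symm hne
        · rw [h1 k h2, h0 k' h3, f_zero, f_last]
        · rw [h1 k' h2, h0 k h3, f_zero, f_last]
    · rw [sum_vtx]
      simp [f_sum]
  have hinj : Function.Injective
      fun t => (⟨_, hmem t⟩ : code (cycleCompleteBridge a b (m + 3))) := by
    intro t t' h
    funext i
    apply balancedWord_injective hb
    funext k
    have h1 := congrFun (congrArg Subtype.val h) (vtx ⟨i + (b - a), by omega⟩ k)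
    simpa [f] using h1
  have := Nat.card_le_card_of_injective _ hinj
  simpa [Nat.card_eq_fintype_card, ← pow_mul] using this

/-! ### The limit of the rate -/

theorem rate_le {a b n : ℕ} (hab : a ≤ b) (hb : 0 < b) (hn : 3 ≤ n) :
    rate (code (cycleCompleteBridge a b n)) ≤ 3 / n + a / b := by
  obtain ⟨m, rfl⟩ := Nat.exists_eq_add_of_le' hn
  have hb' : (0 : ℝ) < b := by exact_mod_cast hb
  have hm' : (0 : ℝ) < ((m + 3 : ℕ) : ℝ) := by positivity
  have hN1 : (1 : ℝ) < ((b * (m + 3) : ℕ) : ℝ) := by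
    exact_mod_cast (by nlinarith : 1 < b * (m + 3))
  have hC : 0 < Nat.card (code (cycleCompleteBridge a b (m + 3))) :=
    (pow_pos (Nat.succ_pos _) _).trans_le (le_card_code hab hb)
  have h1 : Real.logb ((b * (m + 3) : ℕ) : ℝ) (Nat.card (code (cycleCompleteBridge a b (m + 3)))) ≤
      3 * b + a * (m + 3 : ℕ) := by
    refine (Real.logb_le_logb_of_le hN1 (by exact_mod_cast hC)
      (Nat.cast_le.2 (card_code_le hab hb))).trans_eq ?_
    rw [Nat.cast_pow, Real.logb_pow, Real.logb_self_eq_one hN1, mul_one]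
    push_cast
    ring
  rw [rate]
  refine (div_le_div_of_nonneg_right h1 (Nat.cast_nonneg _)).trans_eq ?_
  rw [Nat.cast_mul]
  field_simp

theorem le_rate {a b n : ℕ} (hab : a ≤ b) (hb : 0 < b) (hn : 3 ≤ n) :
    a / b * (1 - 3 / n) * (1 - Real.log b / Real.log (b * n)) ≤
      rate (code (cycleCompleteBridge a b n)) := by
  obtain ⟨m, rfl⟩ := Nat.exists_eq_add_of_le' hn
  have hb' : (0 : ℝ) < b := by exact_mod_cast hb
  have hm' : (0 : ℝ) < ((m + 3 : ℕ) : ℝ) := by positivity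
  have hN1 : (1 : ℝ) < ((b * (m + 3) : ℕ) : ℝ) := by
    exact_mod_cast (by nlinarith : 1 < b * (m + 3))
  have hlog : 0 < Real.log (b * (m + 3 : ℕ)) := by
    have := Real.log_pos hN1
    rwa [Nat.cast_mul] at this
  have h1 : m * a * Real.logb ((b * (m + 3) : ℕ) : ℝ) (m + 3 : ℕ) ≤
      Real.logb ((b * (m + 3) : ℕ) : ℝ) (Nat.card (code (cycleCompleteBridge a b (m + 3)))) := by
    refine Eq.trans_le ?_ (Real.logb_le_logb_of_le hN1
      (Nat.cast_pos.2 (pow_pos (Nat.succ_pos _) _)) (Nat.cast_le.2 (le_card_code hab hb)))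
    rw [Nat.cast_pow, Real.logb_pow, Nat.cast_mul m a]
  rw [rate]
  refine Eq.trans_le ?_ (div_le_div_of_nonneg_right h1 (Nat.cast_nonneg _))
  -- The loss factor is `log_{bn} n`, since the free entries range over `n` values rather than `bn`.
  have h2 : 1 - Real.log b / Real.log (b * (m + 3 : ℕ)) =
      Real.logb ((b * (m + 3) : ℕ) : ℝ) (m + 3 : ℕ) := by
    rw [Real.logb, Nat.cast_mul, eq_div_iff hlog.ne', sub_mul, one_mul,
      div_mul_cancel₀ _ hlog.ne', Real.log_mul hb'.ne' hm'.ne']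
    ring
  have h3 : (a / b * (1 - 3 / (m + 3 : ℕ)) : ℝ) = m * a / (b * (m + 3) : ℕ) := by
    push_cast at hm' ⊢
    field_simp
    ring
  rw [h2, h3]
  ring

/-- The squeeze works along all `n`; parity matters only for reflexivity. -/
theorem tendsto_rate_cycleCompleteBridge {a b : ℕ} (hab : a ≤ b) (hb : 0 < b) :
    Tendsto (fun n : ℕ => rate (code (cycleCompleteBridge a b n))) atTop
      (𝓝 ((a : ℝ) / (b : ℝ))) := by
  have hb' : (0 : ℝ) < b := by exact_mod_cast hb
  have h3 : Tendsto (fun n : ℕ => (3 / n : ℝ)) atTop (𝓝 0) :=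
    tendsto_const_nhds.div_atTop tendsto_natCast_atTop_atTop
  have hlog : Tendsto (fun n : ℕ => Real.log b / Real.log (b * n)) atTop (𝓝 0) :=
    tendsto_const_nhds.div_atTop
      (Real.tendsto_log_atTop.comp (tendsto_natCast_atTop_atTop.const_mul_atTop hb'))
  refine tendsto_of_tendsto_of_tendsto_of_le_of_le' (f := fun n : ℕ => _)
    (g := fun n : ℕ => (a / b * (1 - 3 / n) * (1 - Real.log b / Real.log (b * n)) : ℝ))
    (h := fun n : ℕ => (3 / n + a / b : ℝ)) ?_ ?_ ?_ ?_
  · simpa using (tendsto_const_nhds (x := (a / b : ℝ))).mul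
      ((tendsto_const_nhds (x := (1 : ℝ))).sub h3)
      |>.mul ((tendsto_const_nhds (x := (1 : ℝ))).sub hlog)
  · simpa using h3.add_const (a / b : ℝ)
  · filter_upwards [eventually_ge_atTop 3] with n hn using le_rate hab hb hn
  · filter_upwards [eventually_ge_atTop 3] with n hn using rate_le hab hb hn

end LaplacianCode

theorem mainTheorem6 (a b : ℕ) (hab : a ≤ b) (hb : 0 < b) :
    ∃ G : (n : ℕ) → SimpleGraph (Fin (b * n)),
      (∀ n : ℕ, Odd n → 3 ≤ n →
        G n = LaplacianCode.cycleCompleteBridge a b n ∧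
        (G n).Connected ∧
        LaplacianCode.IsReflexive (LaplacianCode.laplacianSimplex (G n))) ∧
      Tendsto (fun n : ℕ => LaplacianCode.rate (LaplacianCode.code (G n)))
        (atTop ⊓ 𝓟 {n : ℕ | Odd n}) (𝓝 ((a : ℝ) / (b : ℝ))) := by
  exact ⟨LaplacianCode.cycleCompleteBridge a b, fun n hn hn3 =>
    ⟨rfl, LaplacianCode.cycleCompleteBridge_connected hb (by omega),
      LaplacianCode.isReflexive_cycleCompleteBridge hb hn hn3⟩,
    (LaplacianCode.tendsto_rate_cycleCompleteBridge hab hb).mono_left inf_le_left⟩
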